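/- Write $e(x)=e^{2\pi i x}$, $\mathbb{U}=\{z\in\mathbb{C}:|z|=1\}$ and $\mathbb{E}_{n<N}\,a(n)=\frac1N\sum_{n=0}^{N-1}a(n)$. Let $q\ge 2$ be an integer and let $f\colon\mathbb{N}_0\to\mathbb{U}$ be $q$-multiplicative, i.e. $f(m+n)=f(m)f(n)$ for all integers $t,m,n\ge 0$ with $m<q^t$ and $q^t\mid n$. Suppose that $f$ is of Gelfond type (of order $1$), i.e. there are constants $c>0$ and $C$ such that $$\sup_{\alpha\in\mathbb{R}}\Bigl|\mathbb{E}_{n<N}\, f(n)e(n\alpha)\Bigr|\le C N^{-c}\qquad\text{for all integers } N\ge 1.$$ Then for every integer $d\ge 1$ there are constants $c_d>0$ and $C_d$ such that $$\sup_{\substack{p\in\mathbb{R}[x]\\ \deg p\le d}}\Bigl|\mathbb{E}_{n<N}\, f(n)e(p(n))\Bigr|\le C_d N^{-c_d}\qquad\text{for all integers } N\ge 1.$$ In particular, $f$ is of Gelfond type of order $d$ for every $d\ge1$: there are $\gamma_d<1$ and $C_d'$ such that $\sup_{p\in\mathbb{R}[x],\,\deg p\le d}\bigl|\sum_{n=0}^{N-1}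 f(n)e(p(n))\bigr|\le C_d' N^{\gamma_d}$ for all $N\ge1$. -/

import Mathlib

open scoped BigOperators

/-- The additive character `e(x) = exp(2πix)`. -/
noncomputable def e (x : ℝ) : ℂ := Complex.exp (2 * Real.pi * Complex.I * x)

/-- A sequence `f : ℕ₀ → 𝕌` is `q`-multiplicative if `f (m + n) = f m * f n` whenever
`m < q ^ t` and `q ^ t ∣ n` for some `t`. -/
def IsQMultiplicative (q : ℕ) (f : ℕ → Circle) : Prop :=
  ∀ t m n : ℕ, m < q ^ t → q ^ t ∣ n → f (m + n) = f m * f n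

/-- `sup_α |𝔼_{n < N} w(n) e(nα)|`, the supremum over all real `α`. -/
noncomputable def supLinear (w : ℕ → ℂ) (N : ℕ) : ℝ :=
  ⨆ α : ℝ, ‖𝔼 n ∈ Finset.range N, w n * e (n * α)‖

/-- `sup_p |𝔼_{n < N} w(n) e(p(n))|`, the supremum over all real polynomials `p` with
`deg p ≤ d`. -/
noncomputable def supPoly (d : ℕ) (w : ℕ → ℂ) (N : ℕ) : ℝ :=
  ⨆ p : {p : Polynomial ℝ // p.natDegree ≤ d},
    ‖𝔼 n ∈ Finset.range N, w n * e (p.1.eval (n : ℝ))‖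

/-- `w` is of Gelfond type of order `d`: there is `γ < 1` such that
`sup_p |∑_{n < N} w(n) e(p(n))| ≪ N ^ γ`, the supremum being over all real polynomials `p` with
`deg p ≤ d`. -/
def IsGelfondType (d : ℕ) (w : ℕ → ℂ) : Prop :=
  ∃ γ : ℝ, γ < 1 ∧ ∃ C : ℝ, ∀ N : ℕ, 1 ≤ N →
    (⨆ p : {p : Polynomial ℝ // p.natDegree ≤ d},
      ‖∑ n ∈ Finset.range N, w n * e (p.1.eval (n : ℝ))‖) ≤ C * (N : ℝ) ^ γ

theorem norm_e (x : ℝ) : ‖e x‖ = 1 := by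
  have h : (2 * Real.pi * Complex.I * x : ℂ) = ((2 * Real.pi * x : ℝ) : ℂ) * Complex.I := by
    push_cast; ring
  rw [e, h, Complex.norm_exp_ofReal_mul_I]

/-- Every family over which a supremum is taken above is bounded, so that these suprema of real
numbers are genuine. -/
theorem bddAbove_sum {ι : Type*} (w : ℕ → ℂ) (N : ℕ) (g : ι → ℕ → ℝ) :
    BddAbove (Set.range fun i => ‖∑ n ∈ Finset.range N, w n * e (g i n)‖) := by
  refine ⟨∑ n ∈ Finset.range N, ‖w n‖, ?_⟩
  rintro _ ⟨i, rfl⟩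
  refine (norm_sum_le _ _).trans (le_of_eq ?_)
  simp [norm_e]

theorem bddAbove_expect {ι : Type*} (w : ℕ → ℂ) (N : ℕ) (g : ι → ℕ → ℝ) :
    BddAbove (Set.range fun i => ‖𝔼 n ∈ Finset.range N, w n * e (g i n)‖) := by
  refine ⟨𝔼 n ∈ Finset.range N, ‖w n‖, ?_⟩
  rintro _ ⟨i, rfl⟩
  simp only [Finset.expect_eq_sum_div_card, norm_div, Finset.card_range, Complex.norm_natCast]
  gcongr
  refine (norm_sum_le _ _).trans (le_of_eq ?_)
  simp [norm_e]

/-! The proof is an induction on the degree, run along the lengths `q ^ T`. For `deg p ≤ r + 2`,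
write `n = m + q ^ t * l` with `m < q ^ t`, so that `f n = f m * f (q ^ t * l)`. Cauchy–Schwarz in
`l` removes `f (q ^ t * l)`, and for fixed `m ≠ m'` the values of `f` at `m` and `m'` are constants.
A large sum therefore forces a large pure Weyl sum with phase `p (m + q ^ t * l) - p (m' + q ^ t *
l)`, of degree at most `r + 1`. Weyl's inequality, obtained by the same differencing
(`exists_rational_approx_of_large_sum`), then puts the leading coefficient near a rational with
denominator `K` at most a constant times a fixed power of `q ^ t`.

On blocks of length `q ^ s` the leading term is thus nearly periodic modulo `K`. Fourier expansion
costs a factor `|K|` and leaves only phases of lower degree (`norm_sum_le_of_rational_approx`). The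
inductive saving `ρ ^ s` beats `K` once `s` is a large multiple of `t`, and the approximation error
is small once `T` is a still larger multiple of `t`. -/

open Finset

/-! ### Additive characters and geometric sums -/

theorem e_add (x y : ℝ) : e (x + y) = e x * e y := by
  rw [e, e, e, ← Complex.exp_add]; push_cast; ring_nf

theorem e_intCast (n : ℤ) : e n = 1 := by
  rw [e, Complex.exp_eq_one_iff]; exact ⟨n, by push_cast; ring⟩

theorem conj_e (x : ℝ) : (starRingEnd ℂ) (e x) = e (-x) := by
  rw [e, e, ← Complex.exp_conj]; simp [Complex.conj_ofNat]

theorem e_eq_of_sub_eq_intCast {x y : ℝ} (n : ℤ) (h : x - y = n) : e x = e y := by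
  rw [show x = y + n by linarith, e_add, e_intCast, mul_one]

theorem e_natCast_mul (n : ℕ) (x : ℝ) : e (n * x) = e x ^ n := by
  rw [e, e, ← Complex.exp_nat_mul]; push_cast; ring_nf

theorem norm_e_sub_one (x : ℝ) : ‖e x - 1‖ = 2 * |Real.sin (Real.pi * x)| := by
  have h := Complex.norm_exp_I_mul_ofReal_sub_one (2 * Real.pi * x)
  rw [e, show (2 * Real.pi * Complex.I * x : ℂ) = Complex.I * ((2 * Real.pi * x : ℝ) : ℂ) by
    push_cast; ring, h, show 2 * Real.pi * x / 2 = Real.pi * x by ring, norm_mul]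
  simp

theorem norm_e_sub_one_le (x : ℝ) : ‖e x - 1‖ ≤ 7 * |x| := by
  rw [norm_e_sub_one]
  have h : |Real.sin (Real.pi * x)| ≤ |Real.pi * x| := Real.abs_sin_le_abs
  rw [abs_mul, abs_of_pos Real.pi_pos] at h
  nlinarith [abs_nonneg x, Real.pi_lt_d2]

theorem four_mul_abs_le_norm_e_sub_one {x : ℝ} (hx : |x| ≤ 1 / 2) : 4 * |x| ≤ ‖e x - 1‖ := by
  rw [norm_e_sub_one]
  have h := Real.mul_abs_le_abs_sin (x := Real.pi * x) (by
    rw [abs_mul, abs_of_pos Real.pi_pos]; nlinarith [Real.pi_pos])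
  rw [abs_mul, abs_of_pos Real.pi_pos, ← mul_assoc, div_mul_cancel₀ _ Real.pi_ne_zero] at h
  linarith

/-- Bound for a geometric sum in terms of the distance from the frequency to the integers. -/
theorem abs_sub_round_mul_norm_sum_le (x : ℝ) (L : ℕ) :
    |x - round x| * ‖∑ n ∈ range L, e (n * x)‖ ≤ 1 / 2 := by
  have h1 : e x = e (x - round x) := e_eq_of_sub_eq_intCast (round x) (by ring)
  have h2 := four_mul_abs_le_norm_e_sub_one (abs_sub_round x)
  have h3 : ‖∑ n ∈ range L, e (n * x)‖ * ‖e x - 1‖ ≤ 2 := by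
    rw [← norm_mul, sum_congr rfl fun n _ => e_natCast_mul n x, geom_sum_mul]
    refine (norm_sub_le _ _).trans ?_
    rw [norm_pow, norm_e]; norm_num
  rw [h1] at h3
  nlinarith [norm_nonneg (∑ n ∈ range L, e (n * x))]

/-! ### Blocks and Cauchy–Schwarz -/

theorem sum_range_mul_blocks {R : Type*} [AddCommMonoid R] (F : ℕ → R) (M L : ℕ) :
    ∑ n ∈ range (M * L), F n = ∑ l ∈ range L, ∑ m ∈ range M, F (m + M * l) := by
  induction L with
  | zero => simp
  | succ L ih =>
    rw [sum_range_succ, ← ih, Nat.mul_succ, sum_range_add]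
    simp only [add_comm]

/-- Cauchy–Schwarz for a sum over `m < M`, `l < L`: a large sum forces a large off-diagonal
correlation. -/
theorem exists_large_correlation {M L : ℕ} (b : ℕ → ℂ) (z : ℕ → ℕ → ℂ) (hb : ∀ l, ‖b l‖ ≤ 1)
    (hz : ∀ m l, ‖z m l‖ ≤ 1) (hM : 0 < M) (hL : 0 < L) {u : ℝ} (hu : 0 ≤ u)
    (hu' : 2 / M < u ^ 2) (h : u * (M * L) ≤ ‖∑ l ∈ range L, b l * ∑ m ∈ range M, z m l‖) :
    ∃ m < M, ∃ m' < M, m ≠ m' ∧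
      u ^ 2 / 2 * L ≤ ‖∑ l ∈ range L, z m l * (starRingEnd ℂ) (z m' l)‖ := by
  by_contra! hcon
  have hM' : (0 : ℝ) < M := by exact_mod_cast hM
  have hL' : (0 : ℝ) < L := by exact_mod_cast hL
  have h1 : ‖∑ l ∈ range L, b l * ∑ m ∈ range M, z m l‖ ≤
      ∑ l ∈ range L, ‖∑ m ∈ range M, z m l‖ := by
    refine (norm_sum_le _ _).trans (sum_le_sum fun l _ => ?_)
    rw [norm_mul]
    exact mul_le_of_le_one_left (norm_nonneg _) (hb l)
  have h2 : (∑ l ∈ range L, ‖∑ m ∈ range M, z m l‖) ^ 2 ≤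
      L * ∑ l ∈ range L, ‖∑ m ∈ range M, z m l‖ ^ 2 := by
    simpa using sq_sum_le_card_mul_sum_sq (s := range L) (f := fun l => ‖∑ m ∈ range M, z m l‖)
  have h3 : ((∑ l ∈ range L, ‖∑ m ∈ range M, z m l‖ ^ 2 : ℝ) : ℂ) =
      ∑ m ∈ range M, ∑ m' ∈ range M, ∑ l ∈ range L, z m l * (starRingEnd ℂ) (z m' l) := by
    push_cast
    simp_rw [← Complex.mul_conj', map_sum, sum_mul_sum]
    rw [sum_comm]
    exact sum_congr rfl fun m _ => sum_comm
  have h4 : ∑ l ∈ range L, ‖∑ m ∈ range M, z m l‖ ^ 2 ≤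
      ∑ m ∈ range M, ∑ m' ∈ range M, ((if m = m' then (L : ℝ) else 0) + u ^ 2 / 2 * L) := by
    have : ∑ l ∈ range L, ‖∑ m ∈ range M, z m l‖ ^ 2 =
        ‖((∑ l ∈ range L, ‖∑ m ∈ range M, z m l‖ ^ 2 : ℝ) : ℂ)‖ := by
      rw [Complex.norm_real, Real.norm_of_nonneg (by positivity)]
    rw [this, h3]
    refine (norm_sum_le _ _).trans (sum_le_sum fun m hm => ?_)
    refine (norm_sum_le _ _).trans (sum_le_sum fun m' hm' => ?_)
    rw [mem_range] at hm hm'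
    split_ifs with hmm
    · refine (norm_sum_le _ _).trans ?_
      have : ∑ l ∈ range L, ‖z m l * (starRingEnd ℂ) (z m' l)‖ ≤ ∑ l ∈ range L, (1 : ℝ) := by
        refine sum_le_sum fun l _ => ?_
        rw [norm_mul, RCLike.norm_conj]
        exact mul_le_one₀ (hz _ _) (norm_nonneg _) (hz _ _)
      rw [sum_const, card_range, nsmul_eq_mul, mul_one] at this
      have : 0 ≤ u ^ 2 / 2 * L := by positivity
      linarith
    · rw [zero_add]
      exact (hcon m hm m' hm' hmm).le
  have h5 : ∑ m ∈ range M, ∑ m' ∈ range M, ((if m = m' then (L : ℝ) else 0) + u ^ 2 / 2 * L) =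
      M * L + M * (M * (u ^ 2 / 2 * L)) := by
    simp_rw [sum_add_distrib, sum_ite_eq]
    simp +contextual
  rw [h5] at h4
  have h6 : (u * (M * L)) ^ 2 ≤ L * (M * L + M * (M * (u ^ 2 / 2 * L))) :=
    (pow_le_pow_left₀ (by positivity) (h.trans h1) 2).trans
      (h2.trans (mul_le_mul_of_nonneg_left h4 hL'.le))
  -- The diagonal gives `M * L` and the rest at most half of the required `u ^ 2 * M ^ 2 * L`, so
  -- `h6` would force `u ^ 2 * M ≤ 2`.
  have h7 : 2 < u ^ 2 * M := by rwa [div_lt_iff₀ hM'] at hu'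
  have h8 : 0 < (u ^ 2 * M - 2) * (M * L ^ 2) := mul_pos (by linarith) (by positivity)
  nlinarith

/-! ### Differencing and Weyl's inequality -/

open Polynomial in
theorem coeff_taylor_top {p : ℝ[X]} {r : ℕ} (hp : p.natDegree ≤ r) (b : ℝ) :
    (taylor b p).coeff r = p.coeff r := by
  have h := natDegree_hasseDeriv_le p r
  rw [taylor_coeff, eq_C_of_natDegree_le_zero (h.trans (by omega)), eval_C, hasseDeriv_coeff]
  simp

-- The `r`-th Hasse derivative of `p` is affine, with slope `r + 1` times the top coefficient.
open Polynomial in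
theorem coeff_taylor_sub_top {p : ℝ[X]} {r : ℕ} (hp : p.natDegree ≤ r + 1) (b b' : ℝ) :
    (taylor b p).coeff r - (taylor b' p).coeff r = (r + 1) * (b - b') * p.coeff (r + 1) := by
  have h := natDegree_hasseDeriv_le p r
  rw [taylor_coeff, taylor_coeff, eq_X_add_C_of_natDegree_le_one (h.trans (by omega))]
  simp only [hasseDeriv_coeff, eval_add, eval_mul, eval_C, eval_X]
  rw [add_comm 1 r, Nat.choose_succ_self_right]
  push_cast
  ring

open Polynomial in
/-- Differencing a polynomial of degree at most `r + 1` along two residue classes modulo `M`. -/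
theorem exists_differenced_polynomial {p : ℝ[X]} {r : ℕ} (hp : p.natDegree ≤ r + 1)
    (M b b' : ℝ) :
    ∃ Q : ℝ[X], Q.natDegree ≤ r ∧
      Q.coeff r = (r + 1) * M ^ r * (b - b') * p.coeff (r + 1) ∧
      ∀ x, Q.eval x = p.eval (b + M * x) - p.eval (b' + M * x) := by
  refine ⟨(taylor b p - taylor b' p).comp (C M * X), ?_, ?_, fun x => ?_⟩
  · rw [natDegree_le_iff_coeff_eq_zero]
    intro N hN
    rw [comp_C_mul_X_coeff, coeff_sub]
    rcases (Nat.succ_le_of_lt hN).eq_or_lt with rfl | h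
    · rw [coeff_taylor_top hp, coeff_taylor_top hp, sub_self, zero_mul]
    · rw [coeff_eq_zero_of_natDegree_lt, coeff_eq_zero_of_natDegree_lt, sub_self, zero_mul]
      all_goals rw [natDegree_taylor]; omega
  · rw [comp_C_mul_X_coeff, coeff_sub, coeff_taylor_sub_top hp]
    ring
  · simp [taylor_eval, eval_comp]
    ring_nf

open Polynomial in
/-- The conclusion of Weyl's inequality for a polynomial phase twisted by a function that
factorizes along `n = m + M * l`. -/
theorem exists_rational_approx_of_large_twisted_sum {r M L : ℕ}
    (weyl : ∀ p : ℝ[X], p.natDegree ≤ r + 1 → ∀ u : ℝ, 0 ≤ u → u ≤ 1 →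
      1 / (M : ℝ) ≤ (u / 2) ^ 2 ^ r →
      u * (M ^ r * L) ≤ ‖∑ n ∈ range (M ^ r * L), e (p.eval (n : ℝ))‖ →
      ∃ K a : ℤ, K ≠ 0 ∧ |(K : ℝ)| ≤ (r + 1).factorial * (M : ℝ) ^ (r + 1) ^ 2 ∧
        |K * p.coeff (r + 1) - a| ≤ M / L)
    (hM : 0 < M) (hL : 0 < L) (a b : ℕ → ℂ) (ha : ∀ m, ‖a m‖ = 1) (hb : ∀ m, ‖b m‖ = 1)
    {p : ℝ[X]} (hp : p.natDegree ≤ r + 2) {u : ℝ} (hu0 : 0 ≤ u) (hu1 : u ≤ 1)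
    (hu : 1 / (M : ℝ) ≤ (u / 2) ^ 2 ^ (r + 1))
    (h : u * (M ^ (r + 1) * L) ≤ ‖∑ l ∈ range (M ^ r * L), b l *
      ∑ m ∈ range M, a m * e (p.eval (m + M * l : ℝ))‖) :
    ∃ K c : ℤ, K ≠ 0 ∧ |(K : ℝ)| ≤ (r + 2).factorial * (M : ℝ) ^ (r + 2) ^ 2 ∧
      |K * p.coeff (r + 2) - c| ≤ M / L := by
  have hM' : (0 : ℝ) < M := by exact_mod_cast hM
  have hM1 : (1 : ℝ) ≤ M := by exact_mod_cast hM
  have hμ : 1 / (M : ℝ) ≤ (u / 2) ^ 2 :=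
    hu.trans (pow_le_pow_of_le_one (by positivity) (by linarith)
      (by rw [pow_succ]; have := Nat.one_le_two_pow (n := r); omega))
  have hμ0 : 0 < 1 / (M : ℝ) := by positivity
  obtain ⟨m, hm, m', hm', hmm, hc⟩ := exists_large_correlation (M := M) (L := M ^ r * L) (u := u) b
    (fun m l => a m * e (p.eval (m + M * l : ℝ))) (fun l => (hb l).le)
    (fun m l => by rw [norm_mul, ha, norm_e, one_mul]) hM (by positivity) hu0
    (by rw [show (2 : ℝ) / M = 2 * (1 / M) by ring]; nlinarith)
    (by push_cast; rwa [← mul_assoc (M : ℝ), ← pow_succ'])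
  obtain ⟨Q, hQd, hQc, hQ⟩ := exists_differenced_polynomial (r := r + 1) hp M m m'
  have hsum : ‖∑ l ∈ range (M ^ r * L), a m * e (p.eval (m + M * l : ℝ)) *
      (starRingEnd ℂ) (a m' * e (p.eval (m' + M * l : ℝ)))‖ =
      ‖∑ l ∈ range (M ^ r * L), e (Q.eval (l : ℝ))‖ := by
    have : ∀ l : ℕ, a m * e (p.eval (m + M * l : ℝ)) *
        (starRingEnd ℂ) (a m' * e (p.eval (m' + M * l : ℝ))) =
        a m * (starRingEnd ℂ) (a m') * e (Q.eval (l : ℝ)) := by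
      intro l
      rw [hQ, sub_eq_add_neg, e_add, map_mul, conj_e]
      ring
    rw [sum_congr rfl fun l _ => this l, ← mul_sum, norm_mul, norm_mul, RCLike.norm_conj, ha, ha,
      one_mul, one_mul]
  rw [hsum] at hc
  -- Since `(u ^ 2 / 2) / 2 = (u / 2) ^ 2`, measuring the threshold in powers of `u / 2` makes each
  -- differencing exactly double the exponent.
  obtain ⟨K, c, hK0, hK, hc⟩ := weyl Q hQd (u ^ 2 / 2) (by positivity) (by nlinarith)
    (by rw [show u ^ 2 / 2 / 2 = (u / 2) ^ 2 by ring, ← pow_mul, ← pow_succ']; exact hu)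
    (by push_cast at hc; exact hc)
  have hmm' : ((m : ℤ) - m') ≠ 0 := by omega
  -- The factor relating the top coefficient of `Q` to that of `p` is absorbed into the denominator.
  refine ⟨K * ((r + 2) * M ^ (r + 1) * (m - m')), c, ?_, ?_, ?_⟩
  · refine mul_ne_zero hK0 (mul_ne_zero (mul_ne_zero (by positivity) (by positivity)) hmm')
  · have hle : |(m : ℝ) - m'| ≤ M := by
      have h1 : (m : ℝ) < M := by exact_mod_cast hm
      have h2 : (m' : ℝ) < M := by exact_mod_cast hm'
      rw [abs_le]
      constructor <;> linarith [Nat.cast_nonneg (α := ℝ) m, Nat.cast_nonneg (α := ℝ) m']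
    push_cast
    rw [abs_mul, abs_mul, abs_of_nonneg (by positivity : (0 : ℝ) ≤ (r + 2) * M ^ (r + 1))]
    calc |(K : ℝ)| * ((r + 2) * M ^ (r + 1) * |(m : ℝ) - m'|)
        ≤ (r + 1).factorial * (M : ℝ) ^ (r + 1) ^ 2 * ((r + 2) * M ^ (r + 1) * M) := by gcongr
      _ = (r + 2).factorial * (M : ℝ) ^ ((r + 1) ^ 2 + (r + 1) + 1) := by
        rw [Nat.factorial_succ (r + 1)]; push_cast; ring
      _ ≤ (r + 2).factorial * (M : ℝ) ^ (r + 2) ^ 2 := by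
        refine mul_le_mul_of_nonneg_left (pow_le_pow_right₀ hM1 ?_) (by positivity)
        nlinarith
  · rw [hQc] at hc
    push_cast at hc ⊢
    convert hc using 3
    ring

open Polynomial in
/-- The conclusion of Weyl's inequality for the leading coefficient `α` of a polynomial phase. -/
theorem exists_rational_approx_of_large_sum (r : ℕ) :
    ∀ (M L : ℕ), 0 < M → 0 < L → ∀ (p : ℝ[X]), p.natDegree ≤ r + 1 → ∀ u : ℝ, 0 ≤ u → u ≤ 1 →
      1 / (M : ℝ) ≤ (u / 2) ^ 2 ^ r →
      u * (M ^ r * L) ≤ ‖∑ n ∈ range (M ^ r * L), e (p.eval (n : ℝ))‖ →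
      ∃ K a : ℤ, K ≠ 0 ∧ |(K : ℝ)| ≤ (r + 1).factorial * (M : ℝ) ^ (r + 1) ^ 2 ∧
        |K * p.coeff (r + 1) - a| ≤ M / L := by
  induction r with
  | zero =>
    intro M L hM hL p hp u hu0 hu1 hu h
    have hM' : (0 : ℝ) < M := by exact_mod_cast hM
    have hL' : (0 : ℝ) < L := by exact_mod_cast hL
    have hM1 : (1 : ℝ) ≤ M := by exact_mod_cast hM
    -- In degree one a large geometric sum puts the frequency near an integer, so no denominator is
    -- needed.
    refine ⟨1, round (p.coeff 1), one_ne_zero, by simpa using hM1, ?_⟩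
    have hsum : ‖∑ n ∈ range (M ^ 0 * L), e (p.eval (n : ℝ))‖ =
        ‖∑ n ∈ range L, e (n * p.coeff 1)‖ := by
      have : ∀ n : ℕ, e (p.eval (n : ℝ)) = e (n * p.coeff 1) * e (p.coeff 0) := by
        intro n
        have h := congrArg (eval (n : ℝ)) (eq_X_add_C_of_natDegree_le_one hp)
        rw [h, ← e_add]
        simp only [eval_add, eval_mul, eval_C, eval_X, mul_comm]
      rw [pow_zero, one_mul, sum_congr rfl fun n _ => this n, ← sum_mul, norm_mul, norm_e, mul_one]
    have hround := abs_sub_round_mul_norm_sum_le (p.coeff 1) L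
    rw [hsum, pow_zero, one_mul] at h
    rw [pow_zero, pow_one, div_le_div_iff₀ hM' two_pos, one_mul] at hu
    rw [Int.cast_one, one_mul, zero_add, le_div_iff₀ hL']
    have h1 : |p.coeff 1 - round (p.coeff 1)| * (u * L) ≤ 1 / 2 :=
      (mul_le_mul_of_nonneg_left h (abs_nonneg _)).trans hround
    have h2 : 0 ≤ |p.coeff 1 - round (p.coeff 1)| * L := by positivity
    calc |p.coeff 1 - round (p.coeff 1)| * L
        ≤ |p.coeff 1 - round (p.coeff 1)| * L * (u * M) :=
          le_mul_of_one_le_right h2 (by linarith)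
      _ = |p.coeff 1 - round (p.coeff 1)| * (u * L) * M := by ring
      _ ≤ 1 / 2 * M := by gcongr
      _ ≤ M := by linarith
  | succ r ih =>
    intro M L hM hL p hp u hu0 hu1 hu h
    refine exists_rational_approx_of_large_twisted_sum (ih M L hM hL) hM hL 1 1 (by simp)
      (by simp) hp hu0 hu1 hu ?_
    rw [pow_succ' M r, mul_assoc, sum_range_mul_blocks] at h
    rw [pow_succ' (M : ℝ) r] at h ⊢
    simpa [mul_assoc] using h

/-! ### Removing a nearly rational leading coefficient -/

/-- Multiplying by a periodic function costs at most a factor of the period, by Fourier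
expansion. -/
theorem norm_sum_mul_periodic_le {H k : ℕ} (hk : 0 < k) (w g : ℕ → ℂ) (hg : ∀ n, ‖g n‖ ≤ 1)
    (hper : ∀ n, g n = g (n % k)) {B : ℝ}
    (hB : ∀ θ : ℝ, ‖∑ h ∈ range H, w h * e (θ * h)‖ ≤ B) :
    ‖∑ h ∈ range H, w h * g h‖ ≤ k * B := by
  have hk' : (k : ℝ) ≠ 0 := by positivity
  have hkC : (k : ℂ) ≠ 0 := by exact_mod_cast hk.ne'
  have orth : ∀ h x : ℕ, x < k →
      ∑ j ∈ range k, e (j * (((h : ℝ) - x) / k)) = if h % k = x then (k : ℂ) else 0 := by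
    intro h x hx
    have hmod : e (((h : ℝ) - x) / k) ^ k = 1 := by
      rw [← e_natCast_mul, mul_div_cancel₀ _ hk']
      exact_mod_cast e_intCast ((h : ℤ) - x)
    rw [sum_congr rfl fun j _ => e_natCast_mul j _]
    split_ifs with hhx
    · have hdiv : ((h : ℝ) - x) / k = ((h / k : ℕ) : ℤ) := by
        rw [div_eq_iff hk', sub_eq_iff_eq_add, ← hhx]
        rw [Int.cast_natCast, ← Nat.cast_mul, ← Nat.cast_add, Nat.div_add_mod']
      rw [hdiv, e_intCast]
      simp
    · have hne : e (((h : ℝ) - x) / k) ≠ 1 := by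
        intro h1
        rw [e, Complex.exp_eq_one_iff] at h1
        obtain ⟨n, hn⟩ := h1
        have hn' : (((h : ℝ) - x) / k : ℝ) = n := by
          have : (2 * Real.pi * Complex.I : ℂ) ≠ 0 := Complex.two_pi_I_ne_zero
          have h2 : ((((h : ℝ) - x) / k : ℝ) : ℂ) = n := by
            apply mul_left_cancel₀ this
            rw [hn]; ring
          exact_mod_cast h2
        rw [div_eq_iff hk'] at hn'
        have hn2 : (h : ℤ) - x = n * k := by exact_mod_cast hn'
        apply hhx
        have h3 : (h : ℤ) % k = x % k :=
          (Int.modEq_iff_dvd.2 ⟨n, by rw [hn2, mul_comm]⟩ : (x : ℤ) ≡ h [ZMOD k]).symm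
        have h4 : h % k = x % k := by exact_mod_cast h3
        rw [h4, Nat.mod_eq_of_lt hx]
      rw [geom_sum_eq hne, hmod, sub_self, zero_div]
  -- Each of the `k ^ 2` pairs `(x, j)` carries weight at most `1 / k`, whence the total factor `k`.
  have key : ∑ h ∈ range H, w h * g h = ∑ x ∈ range k, ∑ j ∈ range k,
      g x * e (-(j * x / k)) * (k : ℂ)⁻¹ * ∑ h ∈ range H, w h * e ((j / k : ℝ) * h) := by
    have : ∀ h : ℕ, w h * g h = ∑ x ∈ range k, ∑ j ∈ range k,
        g x * e (-(j * x / k)) * (k : ℂ)⁻¹ * (w h * e ((j / k : ℝ) * h)) := by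
      intro h
      have h1 : ∀ x ∈ range k, ∑ j ∈ range k,
          g x * e (-(j * x / k)) * (k : ℂ)⁻¹ * (w h * e ((j / k : ℝ) * h)) =
          if h % k = x then w h * g x else 0 := by
        intro x hx
        have h2 : ∀ j : ℕ, g x * e (-(j * x / k)) * (k : ℂ)⁻¹ * (w h * e ((j / k : ℝ) * h)) =
            g x * w h * (k : ℂ)⁻¹ * e (j * (((h : ℝ) - x) / k)) := by
          intro j
          rw [show (j * (((h : ℝ) - x) / k)) = -(j * x / k) + (j / k : ℝ) * h by ring, e_add]
          ring
        rw [sum_congr rfl fun j _ => h2 j, ← mul_sum, orth h x (mem_range.1 hx)]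
        split_ifs
        · field_simp
        · simp
      rw [sum_congr rfl h1, sum_ite_eq, if_pos (mem_range.2 (Nat.mod_lt _ hk)), hper h]
    rw [sum_congr rfl fun h _ => this h, sum_comm]
    refine sum_congr rfl fun x _ => ?_
    rw [sum_comm]
    exact sum_congr rfl fun j _ => (mul_sum _ _ _).symm
  have hterm : ∀ x j : ℕ, ‖g x * e (-(j * x / k)) * (k : ℂ)⁻¹ *
      ∑ h ∈ range H, w h * e ((j / k : ℝ) * h)‖ ≤ (k : ℝ)⁻¹ * B := by
    intro x j
    rw [norm_mul, norm_mul, norm_mul, norm_e, mul_one, norm_inv, Complex.norm_natCast]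
    have h0 : 0 ≤ B := (norm_nonneg _).trans (hB 0)
    have h1 : ‖g x‖ * (k : ℝ)⁻¹ ≤ (k : ℝ)⁻¹ := mul_le_of_le_one_left (by positivity) (hg x)
    exact mul_le_mul h1 (hB _) (norm_nonneg _) (by positivity)
  rw [key]
  refine (norm_sum_le _ _).trans ((sum_le_sum fun x _ => (norm_sum_le _ _).trans
    (sum_le_sum fun j _ => hterm x j)).trans (le_of_eq ?_))
  simp [hk']

open Polynomial in
/-- Replacing the leading coefficient of a polynomial phase by zero, when that coefficient is close
to a rational of small denominator. -/
theorem norm_sum_le_of_rational_approx {d H : ℕ} (hd : 1 ≤ d) (w : ℕ → ℂ) (hw : ∀ n, ‖w n‖ ≤ 1)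
    {B : ℝ} (hB : ∀ p : ℝ[X], p.natDegree ≤ d → ‖∑ h ∈ range H, w h * e (p.eval (h : ℝ))‖ ≤ B)
    {p : ℝ[X]} (hp : p.natDegree ≤ d + 1) {K a : ℤ} (hK : K ≠ 0) {δ : ℝ}
    (ha : |K * p.coeff (d + 1) - a| ≤ δ) :
    ‖∑ h ∈ range H, w h * e (p.eval (h : ℝ))‖ ≤ |(K : ℝ)| * B + H * (7 * (δ * H ^ (d + 1))) := by
  have hKR : (K : ℝ) ≠ 0 := by exact_mod_cast hK
  set β : ℝ := p.coeff (d + 1) - a / K with hβ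
  have hβδ : |β| ≤ δ := by
    have h1 : K * p.coeff (d + 1) - a = K * β := by rw [hβ]; field_simp
    rw [h1, abs_mul] at ha
    have h2 : (1 : ℝ) ≤ |(K : ℝ)| := by exact_mod_cast Int.one_le_abs hK
    exact (le_mul_of_one_le_left (abs_nonneg β) h2).trans ha
  have hδ : 0 ≤ δ := (abs_nonneg _).trans hβδ
  set R : ℝ[X] := p - C (p.coeff (d + 1)) * X ^ (d + 1) with hR
  have hRd : R.natDegree ≤ d := by
    rw [natDegree_le_iff_coeff_eq_zero]
    intro N hN
    rw [hR, coeff_sub, coeff_C_mul_X_pow]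
    split_ifs with h
    · rw [h, sub_self]
    · rw [coeff_eq_zero_of_natDegree_lt (by omega), sub_zero]
  set g : ℕ → ℂ := fun h => e (a * (h : ℝ) ^ (d + 1) / K) with hg
  have hsplit : ∀ h : ℕ, w h * e (p.eval (h : ℝ)) = w h * e (R.eval (h : ℝ)) * g h +
      w h * e (R.eval (h : ℝ)) * g h * (e (β * (h : ℝ) ^ (d + 1)) - 1) := by
    intro h
    have h1 : p.eval (h : ℝ) =
        R.eval (h : ℝ) + a * (h : ℝ) ^ (d + 1) / K + β * (h : ℝ) ^ (d + 1) := by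
      simp only [hR, hβ, eval_sub, eval_mul, eval_C, eval_pow, eval_X]
      ring
    rw [h1, e_add, e_add]
    ring
  have hmain : ‖∑ h ∈ range H, w h * e (R.eval (h : ℝ)) * g h‖ ≤ |(K : ℝ)| * B := by
    have h1 := norm_sum_mul_periodic_le (H := H) (k := K.natAbs) (Int.natAbs_pos.2 hK)
      (fun h => w h * e (R.eval (h : ℝ))) g (fun n => (norm_e _).le) ?_ (B := B) ?_
    · rwa [Nat.cast_natAbs, Int.cast_abs] at h1
    · intro n
      have h2 : (n : ℤ) ^ (d + 1) ≡ ((n % K.natAbs : ℕ) : ℤ) ^ (d + 1) [ZMOD K] := by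
        refine Int.ModEq.pow _ ?_
        push_cast
        rw [Int.modEq_iff_dvd, ← dvd_neg, neg_sub, ← abs_dvd]
        exact Int.dvd_self_sub_emod
      obtain ⟨c, hc⟩ := h2.symm.dvd
      refine e_eq_of_sub_eq_intCast (a * c) ?_
      have hc' : (n : ℝ) ^ (d + 1) - ((n % K.natAbs : ℕ) : ℝ) ^ (d + 1) = K * c := by
        exact_mod_cast hc
      rw [← sub_div, ← mul_sub, hc']
      push_cast
      field_simp
    · intro θ
      -- The Fourier frequency is absorbed into the linear term of `R`, which is why `1 ≤ d` is
      -- needed.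
      have h2 := hB (R + C θ * X) (natDegree_add_le_of_degree_le hRd
        ((natDegree_C_mul_le θ X).trans (natDegree_X_le.trans hd)))
      simpa only [eval_add, eval_mul, eval_C, eval_X, e_add, ← mul_assoc] using h2
  have herr : ‖∑ h ∈ range H, w h * e (R.eval (h : ℝ)) * g h *
      (e (β * (h : ℝ) ^ (d + 1)) - 1)‖ ≤ H * (7 * (δ * H ^ (d + 1))) := by
    have h1 : ∀ h ∈ range H, ‖w h * e (R.eval (h : ℝ)) * g h *
        (e (β * (h : ℝ) ^ (d + 1)) - 1)‖ ≤ 7 * (δ * H ^ (d + 1)) := by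
      intro h hh
      have hh' : (h : ℝ) ≤ H := by exact_mod_cast (mem_range.1 hh).le
      rw [norm_mul, norm_mul, norm_mul, norm_e, norm_e, mul_one, mul_one]
      calc ‖w h‖ * ‖e (β * (h : ℝ) ^ (d + 1)) - 1‖
          ≤ 1 * (7 * |β * (h : ℝ) ^ (d + 1)|) := by
            gcongr
            · exact hw h
            · exact norm_e_sub_one_le _
        _ = 7 * (|β| * (h : ℝ) ^ (d + 1)) := by
            rw [abs_mul, abs_of_nonneg (by positivity : (0 : ℝ) ≤ (h : ℝ) ^ (d + 1)), one_mul]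
        _ ≤ 7 * (δ * H ^ (d + 1)) := by gcongr
    refine (norm_sum_le _ _).trans ((sum_le_sum h1).trans (le_of_eq ?_))
    simp
  rw [sum_congr rfl fun h _ => hsplit h, sum_add_distrib]
  exact (norm_add_le _ _).trans (add_le_add hmain herr)

/-! ### Induction on the degree along powers of `q` -/

open Polynomial in
/-- Geometric decay of the correlations of `f` with polynomial phases of degree at most `d` along
the lengths `q ^ T`. -/
def HasGeometricDecay (q d : ℕ) (f : ℕ → Circle) : Prop :=
  ∃ ρ : ℝ, 0 < ρ ∧ ρ < 1 ∧ ∃ C : ℝ, 0 ≤ C ∧ ∀ (T : ℕ) (p : ℝ[X]), p.natDegree ≤ d →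
    ‖∑ n ∈ range (q ^ T), (f n : ℂ) * e (p.eval (n : ℝ))‖ ≤ C * ρ ^ T * q ^ T

theorem IsQMultiplicative.map_add_pow_mul {q : ℕ} {f : ℕ → Circle} (hf : IsQMultiplicative q f)
    {t m : ℕ} (hm : m < q ^ t) (l : ℕ) : f (m + q ^ t * l) = f m * f (q ^ t * l) :=
  hf t m _ hm (dvd_mul_right _ _)

open Polynomial in
/-- A sum over `q ^ s * L` terms splits into `L` aligned blocks. -/
theorem IsQMultiplicative.norm_sum_le_of_blocks {q : ℕ} {f : ℕ → Circle}
    (hf : IsQMultiplicative q f) (s L : ℕ) (p : ℝ[X]) {B : ℝ}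
    (hB : ∀ x : ℝ, ‖∑ h ∈ range (q ^ s), (f h : ℂ) * e ((taylor x p).eval (h : ℝ))‖ ≤ B) :
    ‖∑ n ∈ range (q ^ s * L), (f n : ℂ) * e (p.eval (n : ℝ))‖ ≤ L * B := by
  rw [sum_range_mul_blocks]
  have h1 : ∀ l ∈ range L, ‖∑ m ∈ range (q ^ s), (f (m + q ^ s * l) : ℂ) *
      e (p.eval ((m + q ^ s * l : ℕ) : ℝ))‖ ≤ B := by
    intro l _
    have h2 : ∀ m ∈ range (q ^ s), (f (m + q ^ s * l) : ℂ) *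
        e (p.eval ((m + q ^ s * l : ℕ) : ℝ)) =
        (f (q ^ s * l) : ℂ) * ((f m : ℂ) * e ((taylor ((q ^ s * l : ℕ) : ℝ) p).eval (m : ℝ))) := by
      intro m hm
      rw [hf.map_add_pow_mul (mem_range.1 hm), taylor_eval, Circle.coe_mul]
      push_cast
      ring
    rw [sum_congr rfl h2, ← mul_sum, norm_mul, Circle.norm_coe, one_mul]
    exact hB _
  refine (norm_sum_le _ _).trans ((sum_le_sum h1).trans (le_of_eq ?_))
  simp

open Polynomial in
/-- Either the sum is small, or the leading coefficient is close to a rational and induction on the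
degree applies on blocks of length `q ^ s`. -/
theorem IsQMultiplicative.norm_sum_le_or {q : ℕ} (hq : 2 ≤ q) {f : ℕ → Circle}
    (hf : IsQMultiplicative q f) {r t s T : ℕ} (ht : (r + 2) * t ≤ T) (hs : s ≤ T) {B : ℝ}
    (hB : ∀ p : ℝ[X], p.natDegree ≤ r + 1 →
      ‖∑ n ∈ range (q ^ s), (f n : ℂ) * e (p.eval (n : ℝ))‖ ≤ B * q ^ s)
    {p : ℝ[X]} (hp : p.natDegree ≤ r + 2) {u : ℝ} (hu0 : 0 ≤ u) (hu1 : u ≤ 1)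
    (hu : 1 / ((q : ℝ) ^ t) ≤ (u / 2) ^ 2 ^ (r + 1)) :
    ‖∑ n ∈ range (q ^ T), (f n : ℂ) * e (p.eval (n : ℝ))‖ ≤ u * q ^ T ∨
    ‖∑ n ∈ range (q ^ T), (f n : ℂ) * e (p.eval (n : ℝ))‖ ≤
      ((r + 2).factorial * (q : ℝ) ^ ((r + 2) ^ 2 * t) * B +
        7 * (q : ℝ) ^ ((r + 2) * t + (r + 2) * s) / q ^ T) * q ^ T := by
  have hq0 : 0 < q := by omega
  have hqR : (0 : ℝ) < q := by exact_mod_cast hq0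
  rcases le_total ‖∑ n ∈ range (q ^ T), (f n : ℂ) * e (p.eval (n : ℝ))‖ (u * q ^ T) with h | h
  · exact Or.inl h
  right
  obtain ⟨v, rfl⟩ := Nat.exists_eq_add_of_le ht
  -- Weyl's inequality is used with `M = q ^ t` and `L = q ^ (t + v)`, so its error `M / L` is `q ^
  -- (-v)`.
  have hlen : q ^ ((r + 2) * t + v) = q ^ t * ((q ^ t) ^ r * q ^ (t + v)) := by ring
  have hlarge : u * (((q ^ t : ℕ) : ℝ) ^ (r + 1) * (q ^ (t + v) : ℕ)) ≤
      ‖∑ l ∈ range ((q ^ t) ^ r * q ^ (t + v)), (f (q ^ t * l) : ℂ) *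
        ∑ m ∈ range (q ^ t), (f m : ℂ) * e (p.eval (m + (q ^ t : ℕ) * l : ℝ))‖ := by
    have hr : u * (((q ^ t : ℕ) : ℝ) ^ (r + 1) * (q ^ (t + v) : ℕ)) =
        u * (q : ℝ) ^ ((r + 2) * t + v) := by push_cast; ring
    rw [hr]
    refine h.trans (le_of_eq ?_)
    · rw [hlen, sum_range_mul_blocks]
      congr 1
      refine sum_congr rfl fun l _ => ?_
      rw [mul_sum]
      refine sum_congr rfl fun m hm => ?_
      rw [hf.map_add_pow_mul (mem_range.1 hm), Circle.coe_mul]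
      push_cast
      ring_nf
  obtain ⟨K, a, hK0, hK, ha⟩ := exists_rational_approx_of_large_twisted_sum
    (exists_rational_approx_of_large_sum r (q ^ t) (q ^ (t + v)) (by positivity) (by positivity))
    (by positivity) (by positivity) _ _ (fun m => Circle.norm_coe (f m))
    (fun l => Circle.norm_coe (f (q ^ t * l))) hp hu0 hu1 (by push_cast; exact hu) hlarge
  obtain ⟨x, hx⟩ := Nat.exists_eq_add_of_le hs
  -- Translation preserves the leading coefficient, so the same `K` and `a` serve every block.
  have hblocks := hf.norm_sum_le_of_blocks s (q ^ x) p fun y =>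
    norm_sum_le_of_rational_approx (H := q ^ s) (by omega : 1 ≤ r + 1) (fun n => (f n : ℂ))
      (fun n => (Circle.norm_coe (f n)).le) hB (p := taylor y p) (by rwa [natDegree_taylor]) hK0
      (a := a) (δ := (q ^ t : ℕ) / (q ^ (t + v) : ℕ)) (by rwa [coeff_taylor_top hp])
  have hB0 : 0 ≤ B * (q : ℝ) ^ s := (norm_nonneg _).trans (hB 0 (by simp))
  rw [← pow_add, ← hx] at hblocks
  refine hblocks.trans ?_
  rw [hx]
  have h1 : |(K : ℝ)| * (B * q ^ s) ≤
      (r + 2).factorial * (q : ℝ) ^ ((r + 2) ^ 2 * t) * (B * q ^ s) := by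
    refine mul_le_mul_of_nonneg_right (hK.trans (le_of_eq ?_)) hB0
    push_cast
    ring
  have h2 : ((q ^ s : ℕ) : ℝ) * (7 * (((q ^ t : ℕ) : ℝ) / (q ^ (t + v) : ℕ) *
      ((q ^ s : ℕ) : ℝ) ^ (r + 2))) =
      7 * (q : ℝ) ^ ((r + 2) * t + (r + 2) * s) / q ^ (s + x) * q ^ s := by
    rw [← hx]
    push_cast
    field_simp
    ring
  rw [show r + 1 + 1 = r + 2 from rfl, h2]
  calc ((q ^ x : ℕ) : ℝ) * (|(K : ℝ)| * (B * q ^ s) +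
        7 * (q : ℝ) ^ ((r + 2) * t + (r + 2) * s) / q ^ (s + x) * q ^ s)
      ≤ ((q ^ x : ℕ) : ℝ) * ((r + 2).factorial * (q : ℝ) ^ ((r + 2) ^ 2 * t) * (B * q ^ s) +
        7 * (q : ℝ) ^ ((r + 2) * t + (r + 2) * s) / q ^ (s + x) * q ^ s) := by gcongr
    _ = _ := by
      rw [pow_add (q : ℝ) s x]
      push_cast
      ring

theorem exists_pow_eq_of_lt_one {x : ℝ} (hx0 : 0 < x) (hx1 : x < 1) {n : ℕ} (hn : n ≠ 0) :
    ∃ y : ℝ, 0 < y ∧ y < 1 ∧ y ^ n = x :=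
  ⟨x ^ (n⁻¹ : ℝ), Real.rpow_pos_of_pos hx0 _,
    Real.rpow_lt_one hx0.le hx1 (by positivity), Real.rpow_inv_natCast_pow hx0.le hn⟩

open Polynomial in
theorem norm_sum_circle_mul_e_le (f : ℕ → Circle) (p : ℝ[X]) (N : ℕ) :
    ‖∑ n ∈ range N, (f n : ℂ) * e (p.eval (n : ℝ))‖ ≤ N := by
  refine (norm_sum_le _ _).trans (le_of_eq ?_)
  simp [norm_e, Circle.norm_coe]

theorem HasGeometricDecay.succ {q : ℕ} (hq : 2 ≤ q) {f : ℕ → Circle}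
    (hf : IsQMultiplicative q f) {r : ℕ} (h : HasGeometricDecay q (r + 1) f) :
    HasGeometricDecay q (r + 2) f := by
  obtain ⟨ρ, hρ0, hρ1, C, hC, hdecay⟩ := h
  have hqR : (2 : ℝ) ≤ q := by exact_mod_cast hq
  have hq0 : (0 : ℝ) < q := by linarith
  -- With this `σ`, the choice `u = 2 * σ ^ t` gives `(u / 2) ^ 2 ^ (r + 1) = 2 ^ (-t) ≥ q ^ (-t)`,
  -- the Weyl threshold.
  obtain ⟨σ, hσ0, hσ1, hσ⟩ := exists_pow_eq_of_lt_one (x := 1 / 2) (by norm_num) (by norm_num)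
    (n := 2 ^ (r + 1)) (by positivity)
  have hσ2 : 1 / 2 ≤ σ := hσ ▸ pow_le_of_le_one hσ0.le hσ1.le (by positivity)
  -- Taking `s = k * t` lets the inductive saving `ρ ^ s` beat the denominator bound `q ^ ((r + 2) ^
  -- 2 * t)`.
  obtain ⟨k, hk⟩ := exists_pow_lt_of_lt_one
    (y := ρ) (show 0 < 1 / (2 * (q : ℝ) ^ (r + 2) ^ 2) by positivity) hρ1
  have hk' : (q : ℝ) ^ (r + 2) ^ 2 * ρ ^ k ≤ 1 / 2 := by
    rw [lt_div_iff₀ (by positivity)] at hk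
    linarith
  -- The final `+ 1` leaves a spare factor `q ^ (-t)` in the approximation error.
  set A : ℕ := (r + 2) + (r + 2) * k + 1 with hA
  obtain ⟨τ, hτ0, hτ1, hτ⟩ := exists_pow_eq_of_lt_one hσ0 hσ1 (n := A) (by omega)
  refine ⟨τ, hτ0, hτ1, (9 + (r + 2).factorial * C) / σ, by positivity, fun T p hp => ?_⟩
  set t := T / A with ht
  have hAt : A * t ≤ T := Nat.mul_div_le T A
  have hTA : T ≤ A * (t + 1) := (Nat.lt_mul_div_succ T (by omega)).le
  have hτT : σ ^ t ≤ τ ^ T / σ := by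
    rw [le_div_iff₀ hσ0, ← pow_succ, ← hτ, ← pow_mul]
    exact pow_le_pow_of_le_one hτ0.le hτ1.le hTA
  have hhalf : (1 / 2 : ℝ) ^ t ≤ σ ^ t := pow_le_pow_left₀ (by norm_num) hσ2 t
  have hAt' : (r + 2) * t + (r + 2) * (k * t) + t ≤ T := by
    calc _ = A * t := by rw [hA]; ring
      _ ≤ T := hAt
  suffices hmain : ‖∑ n ∈ range (q ^ T), (f n : ℂ) * e (p.eval (n : ℝ))‖ ≤
      (9 + (r + 2).factorial * C) * σ ^ t * q ^ T by
    refine hmain.trans ?_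
    calc (9 + (r + 2).factorial * C) * σ ^ t * (q : ℝ) ^ T
        ≤ (9 + (r + 2).factorial * C) * (τ ^ T / σ) * (q : ℝ) ^ T := by gcongr
      _ = _ := by ring
  have hweak : 2 * σ ^ t * (q : ℝ) ^ T ≤ (9 + (r + 2).factorial * C) * σ ^ t * q ^ T := by
    gcongr
    have : 0 ≤ (r + 2).factorial * C := by positivity
    linarith
  rcases le_or_gt (2 * σ ^ t) 1 with hu | hu
  · have hs : k * t ≤ T := by nlinarith
    have hσu : 1 / (q : ℝ) ^ t ≤ (2 * σ ^ t / 2) ^ 2 ^ (r + 1) := by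
      rw [mul_div_cancel_left₀ _ two_ne_zero, ← pow_mul, mul_comm t, pow_mul, hσ, one_div_pow]
      gcongr
    rcases hf.norm_sum_le_or hq (r := r) (t := t) (s := k * t) (T := T)
      (B := C * ρ ^ (k * t)) ((Nat.le_add_right _ _).trans ((Nat.le_add_right _ _).trans hAt')) hs (fun p hp => hdecay (k * t) p hp) hp
      (u := 2 * σ ^ t) (by positivity) hu hσu with h | h
    · exact h.trans hweak
    · refine h.trans (mul_le_mul_of_nonneg_right ?_ (by positivity))
      have h1 : (q : ℝ) ^ ((r + 2) ^ 2 * t) * ρ ^ (k * t) ≤ σ ^ t := by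
        rw [pow_mul, pow_mul, ← mul_pow]
        exact (pow_le_pow_left₀ (by positivity) (hk'.trans hσ2) t)
      have h2 : (q : ℝ) ^ ((r + 2) * t + (r + 2) * (k * t)) / q ^ T ≤ σ ^ t := by
        refine le_trans ?_ hhalf
        rw [div_le_iff₀ (by positivity), one_div, inv_pow, ← div_eq_inv_mul,
          le_div_iff₀ (by positivity)]
        calc (q : ℝ) ^ ((r + 2) * t + (r + 2) * (k * t)) * 2 ^ t
            ≤ (q : ℝ) ^ ((r + 2) * t + (r + 2) * (k * t)) * q ^ t := by gcongr
          _ = (q : ℝ) ^ ((r + 2) * t + (r + 2) * (k * t) + t) := by rw [← pow_add]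
          _ ≤ q ^ T := pow_le_pow_right₀ (by linarith) hAt'
      calc (r + 2).factorial * (q : ℝ) ^ ((r + 2) ^ 2 * t) * (C * ρ ^ (k * t)) +
            7 * (q : ℝ) ^ ((r + 2) * t + (r + 2) * (k * t)) / q ^ T
          = (r + 2).factorial * C * ((q : ℝ) ^ ((r + 2) ^ 2 * t) * ρ ^ (k * t)) +
            7 * ((q : ℝ) ^ ((r + 2) * t + (r + 2) * (k * t)) / q ^ T) := by ring
        _ ≤ (r + 2).factorial * C * σ ^ t + 7 * σ ^ t := by gcongr
        _ ≤ _ := by nlinarith [pow_pos hσ0 t]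
  · refine (norm_sum_circle_mul_e_le f p _).trans (le_trans ?_ hweak)
    push_cast
    nlinarith [pow_pos hq0 T]

/-! ### Degree one, arbitrary lengths and the conclusion -/

open Polynomial in
theorem hasGeometricDecay_one {q : ℕ} (hq : 2 ≤ q) {f : ℕ → Circle} {c C : ℝ} (hc : 0 < c)
    (hG : ∀ N : ℕ, 1 ≤ N → supLinear (fun n => (f n : ℂ)) N ≤ C * (N : ℝ) ^ (-c)) :
    HasGeometricDecay q 1 f := by
  have hqR : (1 : ℝ) < q := by exact_mod_cast (by omega : 1 < q)
  have hq0 : (0 : ℝ) < q := by linarith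
  refine ⟨(q : ℝ) ^ (-c), Real.rpow_pos_of_pos hq0 _,
    Real.rpow_lt_one_of_one_lt_of_neg hqR (by linarith), |C|, abs_nonneg C, fun T p hp => ?_⟩
  have h1 := (le_ciSup (bddAbove_expect (fun n => (f n : ℂ)) (q ^ T)
    (fun (α : ℝ) (n : ℕ) => n * α)) (p.coeff 1)).trans (hG (q ^ T) (Nat.one_le_pow _ _ (by omega)))
  rw [expect_eq_sum_div_card, norm_div, card_range, Complex.norm_natCast,
    div_le_iff₀ (by positivity)] at h1
  have h2 : ∀ n : ℕ, (f n : ℂ) * e (p.eval (n : ℝ)) =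
      (f n : ℂ) * e (n * p.coeff 1) * e (p.coeff 0) := by
    intro n
    have h := congrArg (eval (n : ℝ)) (eq_X_add_C_of_natDegree_le_one hp)
    rw [h, mul_assoc, ← e_add]
    simp only [eval_add, eval_mul, eval_C, eval_X, mul_comm]
  rw [sum_congr rfl fun n _ => h2 n, ← sum_mul, norm_mul, norm_e, mul_one]
  refine h1.trans ?_
  have h3 : ((q ^ T : ℕ) : ℝ) ^ (-c) = ((q : ℝ) ^ (-c)) ^ T := by
    push_cast
    rw [← Real.rpow_natCast, ← Real.rpow_natCast, ← Real.rpow_mul hq0.le, ← Real.rpow_mul hq0.le,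
      mul_comm]
  rw [h3]
  push_cast
  gcongr
  exact le_abs_self C

-- Aligned blocks of length `q ^ s` comparable to `√N` inherit the decay, and the incomplete last
-- block is trivially negligible.
open Polynomial in
theorem HasGeometricDecay.norm_sum_le {q d : ℕ} (hq : 2 ≤ q) {f : ℕ → Circle}
    (hf : IsQMultiplicative q f) (h : HasGeometricDecay q d f) :
    ∃ c : ℝ, 0 < c ∧ ∃ C : ℝ, 0 ≤ C ∧ ∀ N : ℕ, 1 ≤ N → ∀ p : ℝ[X], p.natDegree ≤ d →
      ‖∑ n ∈ range N, (f n : ℂ) * e (p.eval (n : ℝ))‖ ≤ C * (N : ℝ) ^ (-c) * N := by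
  obtain ⟨ρ, hρ0, hρ1, C, hC, hdecay⟩ := h
  have hqR : (2 : ℝ) ≤ q := by exact_mod_cast hq
  have hq0 : (0 : ℝ) < q := by linarith
  -- The lower bound `1 / 2` ensures `σ ^ s * q ^ s ≥ 1`, so the remainder `x < q ^ s` is at most `σ
  -- ^ s * N`.
  set σ : ℝ := max ρ (1 / 2) with hσ
  have hσ0 : 0 < σ := lt_max_of_lt_left hρ0
  have hσ1 : σ < 1 := max_lt hρ1 (by norm_num)
  have hlogq : 0 < Real.log q := Real.log_pos (by linarith)
  set κ : ℝ := -Real.log σ / Real.log q with hκ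
  have hκ0 : 0 < κ := div_pos (neg_pos.2 (Real.log_neg hσ0 hσ1)) hlogq
  have hκσ : (q : ℝ) ^ (-κ) = σ := by
    rw [Real.rpow_def_of_pos hq0, hκ, neg_div, neg_neg, mul_div_cancel₀ _ hlogq.ne',
      Real.exp_log hσ0]
  refine ⟨κ / 2, by positivity, (C + 1) / σ, by positivity, fun N hN p hp => ?_⟩
  have hN0 : (0 : ℝ) < N := by exact_mod_cast hN
  set s := Nat.log q N / 2 with hs
  have hsN : q ^ s * q ^ s ≤ N := by
    rw [← pow_add]
    exact (Nat.pow_le_pow_right (by omega) (by omega)).trans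
      (Nat.pow_log_le_self q (by omega))
  have hNs : N ≤ q ^ (2 * (s + 1)) :=
    (Nat.lt_pow_succ_log_self (by omega) N).le.trans
      (Nat.pow_le_pow_right (by omega) (by omega))
  have hdecayN : σ ^ s ≤ (N : ℝ) ^ (-(κ / 2)) / σ := by
    rw [le_div_iff₀ hσ0, ← pow_succ]
    have h1 : ((q : ℝ) ^ (2 * (s + 1))) ^ (-(κ / 2)) ≤ (N : ℝ) ^ (-(κ / 2)) :=
      Real.rpow_le_rpow_of_nonpos hN0 (by exact_mod_cast hNs) (by linarith)
    refine le_trans (le_of_eq ?_) h1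
    rw [← hκσ, ← Real.rpow_natCast, ← Real.rpow_natCast, ← Real.rpow_mul hq0.le,
      ← Real.rpow_mul hq0.le]
    congr 1
    push_cast
    ring
  have hqs : 0 < q ^ s := by positivity
  obtain ⟨L, x, hx, hNL⟩ : ∃ L x, x < q ^ s ∧ N = q ^ s * L + x :=
    ⟨N / q ^ s, N % q ^ s, Nat.mod_lt _ hqs, (Nat.div_add_mod _ _).symm⟩
  have hfull : ‖∑ n ∈ range (q ^ s * L), (f n : ℂ) * e (p.eval (n : ℝ))‖ ≤
      L * (C * ρ ^ s * q ^ s) :=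
    hf.norm_sum_le_of_blocks s L p fun y => hdecay s _ (by rwa [natDegree_taylor])
  have hrest : ‖∑ i ∈ range x, (f (q ^ s * L + i) : ℂ) *
      e (p.eval ((q ^ s * L + i : ℕ) : ℝ))‖ ≤ x := by
    refine (_root_.norm_sum_le _ _).trans (le_of_eq ?_)
    simp [norm_e, Circle.norm_coe]
  have hρσ : ρ ^ s ≤ σ ^ s := pow_le_pow_left₀ hρ0.le (le_max_left _ _) s
  have hmain : (L : ℝ) * (C * ρ ^ s * q ^ s) ≤ C * σ ^ s * N := by
    have h1 : (q : ℝ) ^ s * L ≤ N := by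
      rw [hNL]; push_cast; linarith [Nat.cast_nonneg (α := ℝ) x]
    calc (L : ℝ) * (C * ρ ^ s * q ^ s) = C * ρ ^ s * ((q : ℝ) ^ s * L) := by ring
      _ ≤ C * σ ^ s * N := by gcongr
  have hx' : (x : ℝ) ≤ σ ^ s * N := by
    have h1 : (1 / 2 : ℝ) ^ s ≤ σ ^ s := pow_le_pow_left₀ (by norm_num) (le_max_right _ _) s
    have h2 : (q : ℝ) ^ s * q ^ s ≤ N := by exact_mod_cast hsN
    have h3 : (1 : ℝ) ≤ (1 / 2) ^ s * q ^ s := by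
      rw [← mul_pow]
      exact one_le_pow₀ (by linarith)
    calc (x : ℝ) ≤ 1 * q ^ s := by rw [one_mul]; exact_mod_cast hx.le
      _ ≤ ((1 / 2) ^ s * q ^ s) * q ^ s := by gcongr
      _ = (1 / 2) ^ s * (q ^ s * q ^ s) := by ring
      _ ≤ σ ^ s * N := by gcongr
  calc ‖∑ n ∈ range N, (f n : ℂ) * e (p.eval (n : ℝ))‖
      ≤ L * (C * ρ ^ s * q ^ s) + x := by
        rw [hNL, sum_range_add]
        exact (norm_add_le _ _).trans (add_le_add hfull hrest)
    _ ≤ (C + 1) * σ ^ s * N := by linarith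
    _ ≤ (C + 1) * ((N : ℝ) ^ (-(κ / 2)) / σ) * N := by gcongr
    _ = _ := by ring

theorem theoremA (q : ℕ) (hq : 2 ≤ q) (f : ℕ → Circle) (hf : IsQMultiplicative q f)
    (hG : ∃ c : ℝ, 0 < c ∧ ∃ C : ℝ, ∀ N : ℕ, 1 ≤ N →
      supLinear (fun n => (f n : ℂ)) N ≤ C * (N : ℝ) ^ (-c)) :
    ∀ d : ℕ, 1 ≤ d →
      (∃ c : ℝ, 0 < c ∧ ∃ C : ℝ, ∀ N : ℕ, 1 ≤ N →
        supPoly d (fun n => (f n : ℂ)) N ≤ C * (N : ℝ) ^ (-c)) ∧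
      IsGelfondType d (fun n => (f n : ℂ)) := by
  intro d hd
  have hdecay : HasGeometricDecay q d f := by
    induction d, hd using Nat.le_induction with
    | base =>
      obtain ⟨c, hc, C, hC⟩ := hG
      exact hasGeometricDecay_one hq hc hC
    | succ d hd ih =>
      obtain ⟨r, rfl⟩ := Nat.exists_eq_add_of_le' hd
      exact ih.succ hq hf
  obtain ⟨c, hc, C, hC, hbound⟩ := hdecay.norm_sum_le hq hf
  refine ⟨⟨c, hc, C, fun N hN => ?_⟩, 1 - c, by linarith, C, fun N hN => ?_⟩
  all_goals
    have hN0 : (0 : ℝ) < N := by exact_mod_cast hN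
    have : Nonempty {p : Polynomial ℝ // p.natDegree ≤ d} := ⟨⟨0, by simp⟩⟩
    refine ciSup_le fun p => ?_
    have h := hbound N hN p.1 p.2
  · rw [expect_eq_sum_div_card, norm_div, card_range, Complex.norm_natCast, div_le_iff₀ hN0]
    exact h
  · rwa [sub_eq_neg_add, Real.rpow_add_one hN0.ne', ← mul_assoc]
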